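/- Let $F=\mathbb{F}_{2^m}$ with $m\ge 1$, let $\mathrm{Tr}$ be the trace of $F$ over $\mathbb{F}_2$, and for $a\in F$ put $$K(a)=\sum_{x\in F\setminus\{0\}}(-1)^{\mathrm{Tr}(ax+1/x)} .$$ Let $c\in F$. Then each of the following identities holds whenever the denominators occurring in it are nonzero: 1. $K\bigl(c^6(c^2+c+1)/(c+1)^4\bigr)=K\bigl(c^2(c^2+c+1)^3/(c+1)^4\bigr)$; 2. $K\bigl(c^9(c+1)^3/(c^8+c^4+1)\bigr)=K\bigl(c^3(c+1)^9/(c^8+c^4+1)\bigr)$; 3. $K\bigl((c+1)^8(c^4+c)\bigr)=K\bigl(c^3(c^3+1)^3\bigr)$; 4. $K\bigl((c^{11}+c^3)(c^5+1)\bigr)=K\bigl(c(c^5+1)^3\bigr)$; 5. $K\bigl((c+1)^{20}(c^8+c)\bigr)=K\bigl((c+1)^4(c^8+c)^3\bigr)$. -/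

import Mathlib

/-- The Kloosterman sum `K(a) = ∑_{x ∈ F, x ≠ 0} (-1) ^ Tr(a x + 1/x)` over a finite field `F` of
characteristic two, where `Tr` is the trace of `F` over `𝔽₂` (its value in `ZMod 2` is read as
the natural number `0` or `1`). The same formula is used for `a = 0`. -/
noncomputable def kloostermanSum {F : Type*} [Field F] [Fintype F] [DecidableEq F] [Algebra (ZMod 2) F]
    (a : F) : ℤ :=
  ∑ x ∈ Finset.univ.filter (fun x : F => x ≠ 0),
    (-1 : ℤ) ^ (Algebra.trace (ZMod 2) F (a * x + 1 / x)).val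

/-! All five identities specialise K(s³(s+1)) = K(s(s+1)³). Up to normalisation K(a) counts points
on y² + xy = x³ + a, where a point of abscissa s has order three iff a = s³(s+1); the quotient by it
has parameter s(s+1)³, and isogenous curves have equally many points. The proof makes this
elementary. `isogeny` preserves the sign of the summand (`sign_isogeny`), and its fibres are root
sets of cubics. A fibre over X ≠ 0 without exactly one point should force the sign at X to equal
`sign s`, which kills its term in the difference of the sums. For Tr 1 = 1 Cardano's formula proves
this for all fibres. For Tr 1 = 0 only fibres with several points are treated; this gives an
inequality, which s ↦ s + 1 reverses. -/

namespace Kloosterman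

/-! ### Additive character, Artin-Schreier equations and cubics in characteristic two. -/

section Sign

variable {F : Type*} [Field F] [Algebra (ZMod 2) F]

/-- The canonical additive character `x ↦ (-1) ^ Tr x`. -/
noncomputable def sign (x : F) : ℤ := (-1) ^ (Algebra.trace (ZMod 2) F x).val

theorem charTwo (F : Type*) [Field F] [Algebra (ZMod 2) F] : CharP F 2 :=
  charP_of_injective_algebraMap (algebraMap (ZMod 2) F).injective 2

theorem two_eq_zero (F : Type*) [Field F] [Algebra (ZMod 2) F] : (2 : F) = 0 := by
  have := charTwo F
  exact CharTwo.two_eq_zero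

theorem sign_add (x y : F) : sign (x + y) = sign x * sign y := by
  unfold sign
  rw [map_add]
  generalize Algebra.trace (ZMod 2) F x = u
  generalize Algebra.trace (ZMod 2) F y = v
  revert u v
  decide

theorem sign_eq_one_or (x : F) : sign x = 1 ∨ sign x = -1 :=
  neg_one_pow_eq_or ℤ _

theorem sign_mul_self (x : F) : sign x * sign x = 1 := by
  rcases sign_eq_one_or x with h | h <;> simp [h]

theorem trace_eq_zero_of_sign_eq_one {x : F} (h : sign x = 1) :
    Algebra.trace (ZMod 2) F x = 0 := by
  unfold sign at h
  revert h
  generalize Algebra.trace (ZMod 2) F x = u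
  revert u
  decide

variable [Fintype F]

theorem trace_sq (x : F) :
    Algebra.trace (ZMod 2) F (x ^ 2) = Algebra.trace (ZMod 2) F x := by
  have := charTwo F
  have h := Algebra.trace_eq_of_algEquiv (FiniteField.frobeniusAlgEquivOfAlgebraic (ZMod 2) F) x
  simpa [ZMod.card] using h

theorem sign_sq (x : F) : sign (x ^ 2) = sign x := by
  unfold sign
  rw [trace_sq]

theorem sign_sq_add_self (x : F) : sign (x ^ 2 + x) = 1 := by
  rw [sign_add, sign_sq, sign_mul_self]

/-- Adding an Artin-Schreier coboundary does not change the sign. -/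
theorem sign_eq_of_add_eq {x y : F} (g : F) (h : x + y = g ^ 2 + g) : sign x = sign y := by
  have h1 := sign_sq_add_self g
  rw [← h, sign_add] at h1
  rcases sign_eq_one_or x with hx | hx <;> rcases sign_eq_one_or y with hy | hy <;>
    simp_all

/-- Additive Hilbert 90 for the quadratic Artin-Schreier map. -/
theorem exists_sq_add_self_of_sign_eq_one {z : F} (h : sign z = 1) : ∃ y : F, y ^ 2 + y = z := by
  have := charTwo F
  let φ : F →+ F := (frobenius F 2).toAddMonoidHom + AddMonoidHom.id F
  have hφ (y : F) : φ y = y ^ 2 + y := rfl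
  let f : F →ₗ[ZMod 2] F := φ.toZModLinearMap 2
  have hf (y : F) : f y = y ^ 2 + y := rfl
  have hle : LinearMap.range f ≤ LinearMap.ker (Algebra.trace (ZMod 2) F) := by
    rintro _ ⟨y, rfl⟩
    rw [LinearMap.mem_ker, hf, map_add, trace_sq]
    exact CharTwo.add_self_eq_zero _
  have hker : LinearMap.ker f ≤ Submodule.span (ZMod 2) {(1 : F)} := by
    intro y hy
    rw [LinearMap.mem_ker, hf] at hy
    have hy' : y * (y + 1) = 0 := by linear_combination hy
    rcases mul_eq_zero.1 hy' with h0 | h0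
    · simp [h0]
    · have : y = 1 := by linear_combination h0 - two_eq_zero F
      rw [this]
      exact Submodule.mem_span_singleton_self 1
  have hker1 : Module.finrank (ZMod 2) (LinearMap.ker f) ≤ 1 :=
    (Submodule.finrank_mono hker).trans (finrank_span_singleton (one_ne_zero)).le
  have htr : Module.finrank (ZMod 2) (LinearMap.range (Algebra.trace (ZMod 2) F)) = 1 := by
    rw [LinearMap.range_eq_top.2 (Algebra.trace_surjective (ZMod 2) F), finrank_top,
      Module.finrank_self]
  have e1 := LinearMap.finrank_range_add_finrank_ker f
  have e2 := LinearMap.finrank_range_add_finrank_ker (Algebra.trace (ZMod 2) F)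
  -- The range of `f` has codimension at most one, the kernel of the trace exactly one.
  have heq := Submodule.eq_of_le_of_finrank_le hle (by omega)
  have hz : z ∈ LinearMap.range f := by
    rw [heq, LinearMap.mem_ker]
    exact trace_eq_zero_of_sign_eq_one h
  obtain ⟨y, hy⟩ := hz
  exact ⟨y, hy⟩

/-- If `Tr 1 = 1`, there is no primitive cube root of unity, so cubing is bijective. -/
theorem exists_cube_root (h1 : sign (1 : F) = -1) (z : F) : ∃ u : F, u ^ 3 = z := by
  have hinj : Function.Injective (fun u : F => u ^ 3) := by
    intro u v huv
    simp only at huv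
    by_contra hne
    have hv : v ≠ 0 := by
      rintro rfl
      exact hne (by simpa using huv)
    have hd : u - v ≠ 0 := sub_ne_zero.2 hne
    have hq : u ^ 2 + u * v + v ^ 2 = 0 := by
      apply mul_left_cancel₀ hd
      linear_combination huv
    have hw : (u / v) ^ 2 + u / v = 1 := by
      field_simp
      linear_combination hq - v ^ 2 * two_eq_zero F
    have := sign_sq_add_self (u / v)
    rw [hw, h1] at this
    norm_num at this
  exact Finite.surjective_of_injective hinj z

/-- A depressed cubic over a finite field of characteristic two with two distinct roots. -/
theorem sign_cubic_of_two_roots {A B z w : F} (hB : B ≠ 0) (hzw : z ≠ w)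
    (hz : z ^ 3 + A * z + B = 0) (hw : w ^ 3 + A * w + B = 0) :
    sign (A ^ 3 / B ^ 2) = sign (1 : F) := by
  have h2 := two_eq_zero F
  -- With no quadratic term, the third root is z + w.
  have hA : A = z ^ 2 + z * w + w ^ 2 := by
    apply mul_left_cancel₀ (sub_ne_zero.2 hzw)
    linear_combination hz - hw - (z ^ 3 - w ^ 3) * h2
  have hB' : B = z * w * (z + w) := by
    rw [hA] at hz
    linear_combination hz - (z ^ 3 + z ^ 2 * w + z * w ^ 2) * h2
  have hz0 : z ≠ 0 := by
    rintro rfl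
    simp [hB'] at hB
  have hw0 : w ≠ 0 := by
    rintro rfl
    simp [hB'] at hB
  have hs0 : z + w ≠ 0 := by
    intro h
    simp [hB', h] at hB
  apply sign_eq_of_add_eq (w / z + z ^ 2 / (w * (z + w)))
  rw [hA, hB']
  field_simp
  grind

/-- Cardano's formula in characteristic two, when cubing is bijective. -/
theorem exists_root_cubic (h1 : sign (1 : F) = -1) {A B : F} (hB : B ≠ 0)
    (h : sign (A ^ 3 / B ^ 2) = 1) : ∃ z : F, z ^ 3 + A * z + B = 0 := by
  have h2 := two_eq_zero F
  by_cases hA : A = 0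
  · obtain ⟨u, hu⟩ := exists_cube_root h1 B
    exact ⟨u, by rw [hA, hu]; linear_combination B * h2⟩
  -- B y and B (y + 1) are the roots of T² + B T + A³; cube roots u, v with u v = A give the root u
  -- + v.
  obtain ⟨y, hy⟩ := exists_sq_add_self_of_sign_eq_one h
  obtain ⟨u, hu⟩ := exists_cube_root h1 (B * y)
  have hA3 : A ^ 3 = (y ^ 2 + y) * B ^ 2 := by
    rw [hy]
    field_simp
  have hy0 : y ≠ 0 := by
    rintro rfl
    simp [hA] at hA3
  have hu0 : u ≠ 0 := by
    rintro rfl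
    exact mul_ne_zero hB hy0 (by simpa using hu.symm)
  refine ⟨u + A / u, ?_⟩
  have e : (A / u) ^ 3 = B * (y + 1) := by
    rw [div_pow, hu, hA3]
    field_simp
  have e' : A / u * u = A := div_mul_cancel₀ A hu0
  generalize A / u = v at e e'
  rw [← e']
  linear_combination hu + e + (2 * u ^ 2 * v + 2 * u * v ^ 2 + B * y + B) * h2

end Sign

/-! ### The 3-isogeny and comparison of the two sums. -/

section Isogeny

variable {F : Type*} [Field F] [Fintype F] [Algebra (ZMod 2) F]

/-- Substitute x ↦ 1/x², a bijection by Frobenius, and use Tr(t²) = Tr t. -/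
theorem sum_eq_sum_weierstrass [DecidableEq F] (a : F) :
    kloostermanSum a = ∑ x ∈ Finset.univ.filter (fun x : F => x ≠ 0), sign (x + a / x ^ 2) := by
  have := charTwo F
  unfold kloostermanSum
  symm
  have hinj : Function.Injective (fun x : F => (x ^ 2)⁻¹) := fun x y h =>
    frobenius_inj F 2 (inv_injective h)
  have hbij := Finite.injective_iff_bijective.1 hinj
  refine Finset.sum_bijective _ hbij (by simp) ?_
  intro x _
  change _ = sign _
  rw [sign_add, sign_add, div_inv_eq_mul, one_mul, sign_sq, div_eq_mul_inv, mul_comm]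

/-- The `x`-coordinate of the 3-isogeny whose kernel is generated by a point with abscissa `s`. -/
def isogeny (s x : F) : F := x * (x ^ 2 + s ^ 2 + s) / (x + s) ^ 2

theorem sign_isogeny {s x : F} (hx : x ≠ 0) (hs : x + s ≠ 0) (hr : x ^ 2 + s ^ 2 + s ≠ 0) :
    sign (isogeny s x + s * (s + 1) ^ 3 / isogeny s x ^ 2) =
      sign (x + s ^ 3 * (s + 1) / x ^ 2) := by
  have h2 := two_eq_zero F
  apply sign_eq_of_add_eq (s / (x + s) + x ^ 2 / (x ^ 2 + s ^ 2 + s))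
  unfold isogeny
  field_simp
  grind

-- Shifting by X removes the quadratic term of x(x² + s² + s) + X(x + s)².
omit [Fintype F] in
theorem cubic_of_isogeny_eq {s x X : F} (hs : x + s ≠ 0) (h : isogeny s x = X) :
    (x + X) ^ 3 + (X ^ 2 + s ^ 2 + s) * (x + X) + s * X = 0 := by
  have h2 := two_eq_zero F
  unfold isogeny at h
  rw [div_eq_iff (pow_ne_zero 2 hs)] at h
  grind

/-- Ties the splitting of the fibre cubic over X to the summand at X. -/
theorem sign_resolvent {s X : F} (hs : s ≠ 0) (hX : X ≠ 0) :
    sign ((X ^ 2 + s ^ 2 + s) ^ 3 / (s * X) ^ 2) =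
      sign (X + s * (s + 1) ^ 3 / X ^ 2) * sign s * sign (1 : F) := by
  have h2 := two_eq_zero F
  rw [← sign_add, ← sign_add]
  apply sign_eq_of_add_eq (X ^ 2 / s + X + s)
  field_simp
  grind

/-- Fibrewise comparison of the two Kloosterman sums along the 3-isogeny. -/
theorem sign_mul_kloostermanSum_sub [DecidableEq F] {s : F} (hs : s ≠ 0) (hs1 : s + 1 ≠ 0) :
    ∃ N : F → ℕ,
      (∀ X, X ≠ 0 → N X ≠ 1 → (1 < N X ∨ sign (1 : F) = -1) →
        sign (X + s * (s + 1) ^ 3 / X ^ 2) = sign s) ∧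
      sign s * (kloostermanSum (s * (s + 1) ^ 3) - kloostermanSum (s ^ 3 * (s + 1))) =
        ∑ X ∈ Finset.univ.filter (fun X : F => X ≠ 0),
          (1 - (N X : ℤ)) * (sign s * sign (X + s * (s + 1) ^ 3 / X ^ 2) - 1) := by
  have h2 := two_eq_zero F
  have := charTwo F
  obtain ⟨r, hr⟩ : ∃ r : F, r ^ 2 = s ^ 2 + s := by
    obtain ⟨r, hr⟩ := FiniteField.isSquare_of_char_two (ringChar.eq F 2) (s ^ 2 + s)
    exact ⟨r, by rw [hr, sq]⟩
  have hr0 : r ≠ 0 := by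
    rintro rfl
    exact mul_ne_zero hs hs1 (by linear_combination -hr)
  have hrs : r ≠ s := by
    rintro rfl
    exact hs (by linear_combination -hr)
  have hroot (x : F) : x ^ 2 + s ^ 2 + s = 0 ↔ x = r := by
    refine ⟨fun h => ?_, fun h => by rw [h, hr]; linear_combination (s ^ 2 + s) * h2⟩
    apply frobenius_inj F 2
    change x ^ 2 = r ^ 2
    linear_combination h - hr - (s ^ 2 + s) * h2
  have hadd (x : F) : x + s = 0 ↔ x = s :=
    ⟨fun h => by linear_combination h - s * h2, fun h => by rw [h]; linear_combination s * h2⟩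
  let P : Finset F := Finset.univ.filter (fun X : F => X ≠ 0)
  let D : Finset F := (P.erase s).erase r
  have hD (x : F) : x ∈ D ↔ x ≠ 0 ∧ x + s ≠ 0 ∧ x ^ 2 + s ^ 2 + s ≠ 0 := by
    simp only [D, P, Finset.mem_erase, Finset.mem_filter, Finset.mem_univ, true_and, ne_eq,
      hroot, hadd]
    tauto
  have hsP : s ∈ P := by simp [P, hs]
  have hrP : r ∈ P.erase s := by simp [P, hr0, hrs]
  let φ : F → ℤ := fun x => sign (x + s ^ 3 * (s + 1) / x ^ 2)
  let ψ : F → ℤ := fun X => sign (X + s * (s + 1) ^ 3 / X ^ 2)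
  let N : F → ℕ := fun X => (D.filter (fun x => isogeny s x = X)).card
  have hmaps : ∀ x ∈ D, isogeny s x ∈ P := by
    intro x hx
    obtain ⟨h0, h1, h3⟩ := (hD x).1 hx
    simp only [P, Finset.mem_filter, Finset.mem_univ, true_and, isogeny]
    exact div_ne_zero (mul_ne_zero h0 h3) (pow_ne_zero 2 h1)
  have hφs : φ s = sign s := by
    refine sign_eq_of_add_eq s ?_
    field_simp
    grind
  have hφr : φ r = sign s := by
    refine sign_eq_of_add_eq r ?_
    rw [hr]
    have : s ^ 2 + s ≠ 0 := hr ▸ pow_ne_zero 2 hr0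
    field_simp
    ring
  have hK : kloostermanSum (s ^ 3 * (s + 1)) = ∑ X ∈ P, (N X : ℤ) * ψ X + 2 * sign s := by
    rw [sum_eq_sum_weierstrass]
    change ∑ x ∈ P, φ x = _
    rw [← Finset.add_sum_erase P φ hsP, ← Finset.add_sum_erase _ φ hrP, hφs, hφr,
      ← Finset.sum_fiberwise_of_maps_to hmaps]
    have : ∀ X ∈ P, ∑ x ∈ D with isogeny s x = X, φ x = (N X : ℤ) * ψ X := by
      intro X _
      rw [← nsmul_eq_mul]
      apply Finset.sum_eq_card_nsmul
      intro x hx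
      obtain ⟨hxD, rfl⟩ := Finset.mem_filter.1 hx
      obtain ⟨h0, h1, h3⟩ := (hD x).1 hxD
      exact (sign_isogeny h0 h1 h3).symm
    rw [Finset.sum_congr rfl this]
    ring
  -- The 2 counts the abscissas outside `D`: the pole s and the zero r of the isogeny.
  have hN : ∑ X ∈ P, (1 - (N X : ℤ)) = 2 := by
    have h3 : D.card = ∑ X ∈ P, N X := Finset.card_eq_sum_card_fiberwise hmaps
    have h4 : D.card + 1 = (P.erase s).card := Finset.card_erase_add_one hrP
    have h5 : (P.erase s).card + 1 = P.card := Finset.card_erase_add_one hsP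
    have h6 : (∑ X ∈ P, (N X : ℤ)) = (D.card : ℤ) := by rw [h3]; push_cast; rfl
    rw [Finset.sum_sub_distrib, h6]
    simp only [Finset.sum_const, nsmul_eq_mul, mul_one]
    omega
  refine ⟨N, fun X hX h1 hcase => ?_, ?_⟩
  · have hB : s * X ≠ 0 := mul_ne_zero hs hX
    have hres : sign ((X ^ 2 + s ^ 2 + s) ^ 3 / (s * X) ^ 2) = sign (1 : F) := by
      by_cases hlt : 1 < N X
      · obtain ⟨x, hx, y, hy, hxy⟩ := Finset.one_lt_card.1 hlt
        rw [Finset.mem_filter] at hx hy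
        exact sign_cubic_of_two_roots hB (fun h => hxy (add_right_cancel h))
          (cubic_of_isogeny_eq ((hD x).1 hx.1).2.1 hx.2)
          (cubic_of_isogeny_eq ((hD y).1 hy.1).2.1 hy.2)
      · have hneg := hcase.resolve_left hlt
        rw [hneg]
        refine (sign_eq_one_or _).resolve_left fun hpos => ?_
        obtain ⟨z, hz⟩ := exists_root_cubic hneg hB hpos
        obtain ⟨x, rfl⟩ : ∃ x, z = x + X := ⟨z - X, by ring⟩
        -- At x = 0, s, r the fibre cubic takes the nonzero values s²X, s², sX.
        have hx0 : x ≠ 0 := by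
          rintro rfl
          apply mul_ne_zero (pow_ne_zero 2 hs) hX
          grind
        have hxs : x + s ≠ 0 := by
          grind
        have hxr : x ^ 2 + s ^ 2 + s ≠ 0 := by
          grind
        have hx : isogeny s x = X := by
          rw [isogeny, div_eq_iff (pow_ne_zero 2 hxs)]
          grind
        have : 0 < N X := Finset.card_pos.2 ⟨x, Finset.mem_filter.2 ⟨(hD x).2 ⟨hx0, hxs, hxr⟩, hx⟩⟩
        omega
    rw [sign_resolvent hs hX] at hres
    rcases sign_eq_one_or s with e1 | e1 <;>
      rcases sign_eq_one_or (X + s * (s + 1) ^ 3 / X ^ 2) with e2 | e2 <;>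
      rcases sign_eq_one_or (1 : F) with e3 | e3 <;>
      simp_all
  · have hK' : kloostermanSum (s * (s + 1) ^ 3) = ∑ X ∈ P, ψ X := sum_eq_sum_weierstrass _
    have e : ∀ X ∈ P, (1 - (N X : ℤ)) * (sign s * ψ X - 1) =
        sign s * (ψ X - N X * ψ X) - (1 - (N X : ℤ)) := fun X _ => by ring
    change _ = ∑ X ∈ P, (1 - (N X : ℤ)) * (sign s * ψ X - 1)
    rw [Finset.sum_congr rfl e, Finset.sum_sub_distrib, hN, ← Finset.mul_sum,
      Finset.sum_sub_distrib, hK, hK']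
    linear_combination (-2) * sign_mul_self s

/-- Only empty fibres can contribute, and a product of signs minus 1 is at most 0. -/
theorem sign_mul_kloostermanSum_sub_nonpos [DecidableEq F] {s : F} (hs : s ≠ 0)
    (hs1 : s + 1 ≠ 0) :
    sign s * (kloostermanSum (s * (s + 1) ^ 3) - kloostermanSum (s ^ 3 * (s + 1))) ≤ 0 := by
  obtain ⟨N, hN, h⟩ := sign_mul_kloostermanSum_sub hs hs1
  rw [h]
  refine Finset.sum_nonpos fun X hX => ?_
  have hX0 : X ≠ 0 := by simpa using hX
  by_cases hlt : 1 < N X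
  · rw [hN X hX0 hlt.ne' (Or.inl hlt), sign_mul_self]
    simp
  · refine mul_nonpos_of_nonneg_of_nonpos (by omega) ?_
    rw [← sign_add]
    rcases sign_eq_one_or (s + (X + s * (s + 1) ^ 3 / X ^ 2)) with e | e <;> rw [e] <;> norm_num

theorem kloostermanSum_three_isogeny [DecidableEq F] (s : F) :
    kloostermanSum (s ^ 3 * (s + 1)) = kloostermanSum (s * (s + 1) ^ 3) := by
  have h2 := two_eq_zero F
  by_cases hs : s = 0
  · simp [hs]
  by_cases hs1 : s + 1 = 0
  · simp [hs1]
  have hss := sign_mul_self s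
  rcases sign_eq_one_or (1 : F) with h1 | h1
  · have e1 := sign_mul_kloostermanSum_sub_nonpos hs hs1
    have e2 := sign_mul_kloostermanSum_sub_nonpos hs1
      (by rwa [show s + 1 + 1 = s by linear_combination h2])
    rw [show s + 1 + 1 = s by linear_combination h2, sign_add, h1, mul_one,
      mul_comm (s + 1), mul_comm ((s + 1) ^ 3)] at e2
    rcases sign_eq_one_or s with e | e <;> rw [e] at e1 e2 <;> linarith
  · obtain ⟨N, hN, h⟩ := sign_mul_kloostermanSum_sub hs hs1
    rw [Finset.sum_eq_zero] at h
    · rcases sign_eq_one_or s with e | e <;> rw [e] at h <;> linarith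
    · intro X hX
      have hX0 : X ≠ 0 := by simpa using hX
      by_cases hX1 : N X = 1
      · simp [hX1]
      · rw [hN X hX0 hX1 (Or.inr h1), hss]
        simp

end Isogeny

end Kloosterman

/-! ### Specialisations of s. -/

theorem corollary1 {F : Type*} [Field F] [Fintype F] [DecidableEq F] [Algebra (ZMod 2) F]
    (c : F) :
    ((c + 1) ^ 4 ≠ 0 →
      kloostermanSum (c ^ 6 * (c ^ 2 + c + 1) / (c + 1) ^ 4) =
        kloostermanSum (c ^ 2 * (c ^ 2 + c + 1) ^ 3 / (c + 1) ^ 4)) ∧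
    (c ^ 8 + c ^ 4 + 1 ≠ 0 →
      kloostermanSum (c ^ 9 * (c + 1) ^ 3 / (c ^ 8 + c ^ 4 + 1)) =
        kloostermanSum (c ^ 3 * (c + 1) ^ 9 / (c ^ 8 + c ^ 4 + 1))) ∧
    kloostermanSum ((c + 1) ^ 8 * (c ^ 4 + c)) =
      kloostermanSum (c ^ 3 * (c ^ 3 + 1) ^ 3) ∧
    kloostermanSum ((c ^ 11 + c ^ 3) * (c ^ 5 + 1)) =
      kloostermanSum (c * (c ^ 5 + 1) ^ 3) ∧
    kloostermanSum ((c + 1) ^ 20 * (c ^ 8 + c)) =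
      kloostermanSum ((c + 1) ^ 4 * (c ^ 8 + c) ^ 3) := by
  have h2 := Kloosterman.two_eq_zero F
  refine ⟨fun h => ?_, fun h => ?_, ?_, ?_, ?_⟩
  · have hc : c + 1 ≠ 0 := fun h0 => h (by rw [h0]; simp)
    convert Kloosterman.kloostermanSum_three_isogeny (c ^ 2 / (c + 1)) using 2
    · field_simp
      ring
    · field_simp
      ring
  · have hd : c ^ 8 + c ^ 4 + 1 = (c ^ 2 + c + 1) ^ 4 := by
      grind
    have hc : c ^ 2 + c + 1 ≠ 0 := fun h0 => h (by rw [hd, h0]; simp)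
    have hs : c ^ 3 / (c ^ 2 + c + 1) + 1 = (c + 1) ^ 3 / (c ^ 2 + c + 1) := by
      rw [div_add_one hc]
      congr 1
      linear_combination (-c ^ 2 - c) * h2
    convert Kloosterman.kloostermanSum_three_isogeny (c ^ 3 / (c ^ 2 + c + 1)) using 2
    · rw [hd, hs]
      field_simp
    · rw [hd, hs]
      field_simp
  -- In the last three cases (c + 1)(s + 1) is c⁴ + c, c⁵ + 1, c⁸ + c respectively.
  · convert Kloosterman.kloostermanSum_three_isogeny ((c + 1) ^ 3) using 2 <;> grind
  · convert Kloosterman.kloostermanSum_three_isogeny (c * (c + 1) ^ 3) using 2 <;> grind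
  · have hs : (c + 1) ^ 7 + 1 = c * (c ^ 6 + c ^ 5 + c ^ 4 + c ^ 3 + c ^ 2 + c + 1) := by
      linear_combination (3 * c ^ 6 + 10 * c ^ 5 + 17 * c ^ 4 + 17 * c ^ 3 + 10 * c ^ 2 + 3 * c + 1) * h2
    have hc : c ^ 8 + c = (c + 1) * ((c + 1) ^ 7 + 1) := by
      rw [hs]
      grind
    convert Kloosterman.kloostermanSum_three_isogeny ((c + 1) ^ 7) using 2
    · rw [hc]
      ring
    · rw [hc]
      ring
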